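/- Let $n\ge 0$ and $m\ge 1$ be integers. An $MH(n,m)$ is an $n\times n$ matrix $H$ with all entries $\pm1$ such that $HH^{\top}\equiv nI \pmod m$. An integer $n$ is called a quadratic nonresidue of a prime $p$ if it is not congruent to a square modulo $p$ (so multiples of $p$ are not nonresidues). A prime power is a number $\ell^k$ with $\ell$ prime and $k\ge 1$. **Theorem.** Let $p\equiv 3\pmod 4$ be a prime such that $2$ is a primitive root modulo $p$. Suppose that for every integer $\delta$ with $1\le\delta<p$ there exist an odd prime power $q\equiv 1\pmod p$ and a nonnegative integer $d\equiv\delta\pmod p$ such that $r=\frac{q^d-1}{q-1}$ is a prime power with $r\equiv 1\pmod 4$. Then, for all but finitely many nonnegative integers $n$, an $MH(n,p)$ exists if and only if $n$ is not an odd quadratic nonresidue of $p$ (equivalently, if and only if $n$ is even or a square modulo $p$). -/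

import Mathlib

open scoped Matrix

/-- `H` is an `m`-modular Hadamard matrix of size `n`, an `MH(n,m)`: all entries are `1` or `-1`,
and `H Hᵀ ≡ n I (mod m)` entrywise. -/
def IsModularHadamard (n m : ℕ) (H : Matrix (Fin n) (Fin n) ℤ) : Prop :=
  (∀ i j, H i j = 1 ∨ H i j = -1) ∧
    ∀ i j, (H * Hᵀ) i j ≡ ((n : ℤ) • (1 : Matrix (Fin n) (Fin n) ℤ)) i j [ZMOD (m : ℤ)]

/-- An `MH(n,m)` exists. -/
def ExistsMH (n m : ℕ) : Prop :=
  ∃ H : Matrix (Fin n) (Fin n) ℤ, IsModularHadamard n m H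

/-- For every `1 ≤ δ < p` there are an odd prime power `q ≡ 1 (mod p)` and some `d ≡ δ (mod p)`
such that `r = (q ^ d - 1) / (q - 1)` is a prime power with `r ≡ 1 (mod 4)`.
Here `q ≥ 3`, so the natural-number subtractions do not truncate and the division is exact. -/
def PrimePowerCondition (p : ℕ) : Prop :=
  ∀ δ : ℕ, 1 ≤ δ → δ < p →
    ∃ q d r : ℕ, IsPrimePow q ∧ Odd q ∧ q ≡ 1 [MOD p] ∧ d ≡ δ [MOD p] ∧
      r = (q ^ d - 1) / (q - 1) ∧ IsPrimePow r ∧ r ≡ 1 [MOD 4]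

/-- `n` is a quadratic nonresidue of `p`: `n` is not congruent to a square modulo `p`.
(Multiples of `p` are squares modulo `p`, so they are not nonresidues.) -/
def IsQuadraticNonresidue (p n : ℕ) : Prop :=
  ¬ ∃ x : ℕ, x ^ 2 ≡ n [MOD p]

/-!
Let `n` have residue `a` modulo `p`, and write `PG(h, q)` for the projective space of dimension `h`
over the field with `q` elements.

*Necessity.* If `H Hᵀ ≡ n I` and `n` is odd, then `(det H)² ≡ n ^ n`, so `n` is a square modulo `p`
(`ExistsMH.isSquare_of_odd`).

*Sufficiency for squares* (`finite_setOf_not_existsMH_of_cast_eq_sq`). If `a = 0`, the all-ones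
matrix works; if `a = 4`, the matrix `J - 2I` does. Let `a` be any other square. The squares modulo
`p` are the powers of `4`, so some Hadamard matrix of order `4 ^ k` has `4 ^ k ≡ a`. Its order is
enlarged by blowing up one point (`ExistsMH.blowup`): the first row and the first column are
repeated, and the corner becomes a block proportional to a square sign matrix `A` of order
`v ≡ 1` with row sums `1` and inner products `1 - a` of distinct rows. Rows and columns of such a
block behave modulo `p` like the single point they replace. The points and hyperplanes of
`PG(h, q)` give such an `A`, with `v = 1 + q + ⋯ + q ^ h`, as soon as `q ≡ 4 / a` and
`q ^ h ≡ 1` (`exists_signMatrix_of_prime`). As `4 / a` is a square, `h = (p - 1) / 2` is a possible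
exponent for every prime `q ≡ 4 / a`.

So `n` may be enlarged by any sum of numbers `q + ⋯ + q ^ h` with `q ≡ 4 / a` prime. These
numbers have greatest common divisor `p` (`setGcd_geom_sum_dvd`), hence their sums cover all large
multiples of `p`. That no larger divisor is shared rests on `h` being odd, which is where
`p ≡ 3 (mod 4)` enters: by Dirichlet's theorem there is a prime `q ≡ 4 / a` which is `-1` modulo any
given number prime to `p`, and then `q + ⋯ + q ^ h` is `-1` modulo that number as well.

*Even nonresidues.* As `2` is a primitive root, it is a nonresidue, so if `n = 2m` is a nonresidue
then `m` is a residue, and an `MH(m, p)` doubles to an `MH(2m, p)`.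
-/

/-! ### Sign matrices with orthogonal rows over `ZMod m` -/

/-- All entries of `A` are `1` or `-1`, in a ring that need not have characteristic `0`. -/
def IsSignMatrix {ι κ R : Type*} [Ring R] (A : Matrix ι κ R) : Prop :=
  ∀ i j, A i j = 1 ∨ A i j = -1

/-- A modular Hadamard matrix may be given over `ZMod m` and on any finite index set, and only
distinct rows need checking: a sign vector of length `n` has square `n`. -/
theorem existsMH_of_matrix {ι : Type*} [Fintype ι] {m : ℕ} (H : Matrix ι ι (ZMod m))
    (hs : IsSignMatrix H) (ho : Pairwise fun i j => H i ⬝ᵥ H j = 0) :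
    ExistsMH (Fintype.card ι) m := by
  classical
  let e := (Fintype.equivFin ι).symm
  have hlift : ∀ i j, ((if H i j = 1 then (1 : ℤ) else -1 : ℤ) : ZMod m) = H i j := by
    intro i j
    split_ifs with h
    · simp [h]
    · simp [(hs i j).resolve_left h]
  refine ⟨Matrix.of fun i j => if H (e i) (e j) = 1 then 1 else -1, fun i j => ?_, fun i j => ?_⟩
  · rw [Matrix.of_apply]
    split_ifs <;> simp
  · rw [← ZMod.intCast_eq_intCast_iff]
    simp only [Matrix.mul_apply, Matrix.transpose_apply, Matrix.of_apply, Matrix.smul_apply,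
      Matrix.one_apply, Int.cast_sum, Int.cast_mul, hlift]
    rw [Equiv.sum_comp e fun k => H (e i) k * H (e j) k]
    rcases eq_or_ne i j with rfl | hij
    · have : ∀ k, H (e i) k * H (e i) k = 1 := fun k => by
        rcases hs (e i) k with h | h <;> simp [h]
      simp [this]
    · simpa [hij, dotProduct] using ho (e.injective.ne hij)

theorem ExistsMH.exists_matrix {n m : ℕ} (h : ExistsMH n m) :
    ∃ H : Matrix (Fin n) (Fin n) (ZMod m), IsSignMatrix H ∧
      Pairwise fun i j => H i ⬝ᵥ H j = 0 := by
  obtain ⟨H, hs, ho⟩ := h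
  refine ⟨fun i j => H i j, fun i j => ?_, fun i j hij => ?_⟩
  · rcases hs i j with h | h <;> simp [h]
  · have := (ZMod.intCast_eq_intCast_iff _ _ _).2 (ho i j)
    simpa [Matrix.mul_apply, hij, dotProduct] using this

/-- The determinant of an `MH(n, p)` squares to `n ^ n`. -/
theorem ExistsMH.isSquare_of_odd {n p : ℕ} [Fact p.Prime] (h : ExistsMH n p) (hn : Odd n) :
    IsSquare (n : ZMod p) := by
  obtain ⟨H, hs, ho⟩ := h.exists_matrix
  have hgram : H * Hᵀ = (n : ZMod p) • 1 := by
    ext i j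
    rcases eq_or_ne i j with rfl | hij
    · have : ∀ k, H i k * H i k = 1 := fun k => by
        rcases hs i k with h | h <;> simp [h]
      simp [Matrix.mul_apply, this]
    · simpa [Matrix.mul_apply, hij, dotProduct] using ho hij
  have hdet := congrArg Matrix.det hgram
  rw [Matrix.det_mul, Matrix.det_transpose, Matrix.det_smul, Matrix.det_one, mul_one,
    Fintype.card_fin] at hdet
  obtain ⟨k, hk⟩ := hn
  rcases eq_or_ne (n : ZMod p) 0 with h0 | h0
  · exact ⟨0, by simp [h0]⟩
  · refine ⟨H.det / (n : ZMod p) ^ k, ?_⟩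
    rw [div_mul_div_comm, hdet, eq_div_iff (by positivity)]
    calc (n : ZMod p) * (n ^ k * n ^ k) = n ^ (2 * k + 1) := by ring
      _ = n ^ n := by rw [← hk]

/-! ### Constructions of modular Hadamard matrices -/

theorem existsMH_of_cast_eq_zero {n m : ℕ} (h : (n : ZMod m) = 0) : ExistsMH n m := by
  have := existsMH_of_matrix (m := m) (ι := Fin n) (fun _ _ => 1) (fun _ _ => Or.inl rfl)
    (fun i j _ => by simpa [dotProduct] using h)
  simpa using this

/-- The matrix `J - 2I` satisfies `(J - 2I)² = (n - 4)J + 4I`. -/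
theorem existsMH_of_cast_eq_four {n m : ℕ} (h : (n : ZMod m) = 4) : ExistsMH n m := by
  have := existsMH_of_matrix (m := m) (ι := Fin n) (fun i j => if i = j then -1 else 1)
    (fun i j => by dsimp only; split_ifs <;> simp) (fun i j hij => by
      have : ∀ k, ((if i = k then (-1 : ZMod m) else 1) * if j = k then -1 else 1)
          = 1 - 2 * (if i = k then 1 else 0) - 2 * (if j = k then 1 else 0) := by
        intro k
        by_cases h1 : i = k <;> by_cases h2 : j = k
        · exact absurd (h1.trans h2.symm) hij
        all_goals simp [h1, h2]; try norm_num
      simp only [dotProduct, this, Finset.sum_sub_distrib, ← Finset.mul_sum]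
      simp [h]; norm_num)
  simpa using this

theorem ExistsMH.two_mul {n m : ℕ} (h : ExistsMH n m) : ExistsMH (2 * n) m := by
  obtain ⟨H, hs, ho⟩ := h.exists_matrix
  have := existsMH_of_matrix (Matrix.fromBlocks H H H (-H)) ?_ ?_
  · rw [_root_.two_mul]
    simpa using this
  · rintro (i | i) (j | j) <;> rcases hs i j with h | h <;> simp [h]
  · have key : ∀ i j, i ≠ j → ∑ k, H i k * H j k = 0 := fun i j hij => ho hij
    rintro (i | i) (j | j) hij
    · have := key i j (by simpa using hij)
      simp [dotProduct, this]
    · simp [dotProduct]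
    · simp [dotProduct]
    · have := key i j (by simpa using hij)
      simp [dotProduct, this]

theorem existsMH_two_pow (k m : ℕ) : ExistsMH (2 ^ k) m := by
  induction k with
  | zero => 
    simpa using existsMH_of_matrix (ι := Unit) (m := m) (fun _ _ => 1) (fun _ _ => Or.inl rfl)
      Subsingleton.pairwise
  | succ k ih => rw [pow_succ']; exact ih.two_mul

/-- Blowing up a point: the first row and column of an `MH(n + 1, m)` are replaced by copies indexed
by `κ`, and the corner entry `c` by the block `c A`. Since `A` has order and row sums `1`, the inner
products with the other rows do not change; two rows in the block agree on the `n` old columns,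
which is compensated by their inner product `-n` inside the block. -/
theorem ExistsMH.blowup {n m : ℕ} {κ : Type*} [Fintype κ] (h : ExistsMH (n + 1) m)
    (hcard : (Fintype.card κ : ZMod m) = 1) (A : Matrix κ κ (ZMod m)) (hA : IsSignMatrix A)
    (hrow : ∀ i, ∑ j, A i j = 1)
    (hgram : Pairwise fun i j => A i ⬝ᵥ A j = -(n : ZMod m)) :
    ExistsMH (Fintype.card κ + n) m := by
  obtain ⟨H, hs, ho⟩ := h.exists_matrix
  have key : ∀ i j, i ≠ j → H i 0 * H j 0 + ∑ k : Fin n, H i k.succ * H j k.succ = 0 :=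
    fun i j hij => by simpa [dotProduct, Fin.sum_univ_succ] using ho hij
  have hsq : ∀ i j, H i j * H i j = 1 := fun i j => by
    rcases hs i j with h | h <;> simp [h]
  have hblock : ∀ i j, i ≠ j → ∑ k, A i k * A j k = -(n : ZMod m) := fun i j hij => hgram hij
  have := existsMH_of_matrix
    (Matrix.fromBlocks (Matrix.of fun i j => H 0 0 * A i j)
      (Matrix.of fun _ (j : Fin n) => H 0 j.succ) (Matrix.of fun (i : Fin n) _ => H i.succ 0)
      (Matrix.of fun (i j : Fin n) => H i.succ j.succ)) ?_ ?_
  · simpa using this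
  · rintro (i | i) (j | j)
    · rcases hs 0 0 with h | h <;> rcases hA i j with h' | h' <;> simp [h, h']
    all_goals exact hs _ _
  · rintro (i | i) (j | j) hij
    · have := hblock i j (by simpa using hij)
      have hmul : ∀ k, H 0 0 * A i k * (H 0 0 * A j k) = A i k * A j k := fun k => by
        rw [mul_mul_mul_comm, hsq, one_mul]
      simp [dotProduct, hmul, hsq, this]
    · have := key 0 j.succ (Fin.succ_ne_zero j).symm
      have hmul : ∑ k, H 0 0 * A i k * H j.succ 0 = H 0 0 * H j.succ 0 := by
        rw [← Finset.sum_mul, ← Finset.mul_sum, hrow, mul_one]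
      simpa [dotProduct, hmul] using this
    · have := key i.succ 0 (Fin.succ_ne_zero i)
      have hmul : ∑ k, H i.succ 0 * (H 0 0 * A j k) = H i.succ 0 * H 0 0 := by
        rw [← Finset.mul_sum, ← Finset.mul_sum, hrow, mul_one]
      simpa [dotProduct, hmul] using this
    · have := key i.succ j.succ (by simpa using hij)
      simpa [dotProduct, hcard] using this

/-! ### The sign matrix of points and hyperplanes of a projective space -/

open scoped LinearAlgebra.Projectivization

/-- Each point of `ℙ F V` has `card F - 1` representatives, so sums over points are obtained from
sums over vectors wherever `card F - 1` is invertible. -/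
theorem Projectivization.sum_eq_add_card_sub_one_mul_sum {F V R : Type*} [Field F] [Fintype F]
    [AddCommGroup V] [Module F V] [Fintype V] [Fintype (ℙ F V)] [CommRing R]
    (f : ℙ F V → R) (g : V → R) (hg : ∀ v (hv : v ≠ 0), g v = f (mk F v hv)) :
    ∑ v, g v = g 0 + (Fintype.card F - 1 : R) * ∑ P, f P := by
  classical
  have hfst : ∀ v : {v : V // v ≠ 0},
      (nonZeroEquivProjectivizationProdUnits F V v).1 = mk F v.1 v.2 := fun v => rfl
  have hsum : ∑ v : {v : V // v ≠ 0}, g v = (Fintype.card F - 1 : R) * ∑ P, f P := by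
    calc ∑ v : {v : V // v ≠ 0}, g v
        = ∑ v, (fun x : ℙ F V × Fˣ => f x.1) (nonZeroEquivProjectivizationProdUnits F V v) :=
          Finset.sum_congr rfl fun v _ => by rw [hg v v.2, ← hfst]
      _ = ∑ x : ℙ F V × Fˣ, f x.1 := Equiv.sum_comp _ fun x : ℙ F V × Fˣ => f x.1
      _ = _ := by
        rw [Fintype.sum_prod_type, Finset.mul_sum]
        simp [Fintype.card_units, Nat.cast_sub Fintype.card_pos]
  rw [← hsum, ← Fintype.sum_subtype_add_sum_subtype (· = 0) g]
  simp [show ((default : {v : V // v = 0}) : V) = 0 from rfl]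

theorem Matrix.card_ker_mulVec_mul_pow {F ι : Type*} [Field F] [Fintype F] [DecidableEq F]
    [Fintype ι] [DecidableEq ι] {m : ℕ}
    (M : Matrix (Fin m) ι F) (hM : LinearIndependent F M.row) :
    Fintype.card {v : ι → F // M *ᵥ v = 0} * Fintype.card F ^ m
      = Fintype.card F ^ Fintype.card ι := by
  have hsurj : LinearMap.range M.mulVecLin = ⊤ := by
    apply Submodule.eq_top_of_finrank_eq
    have := hM.rank_matrix
    rw [Matrix.rank] at this
    simpa using this
  have h := M.mulVecLin.ker.card_eq_card_quotient_mul_card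
  rw [Nat.card_congr (M.mulVecLin.quotKerEquivRange.trans
    (LinearEquiv.ofTop _ hsurj)).toEquiv] at h
  simp only [Nat.card_eq_fintype_card, Fintype.card_fun, Fintype.card_fin] at h
  rw [h, ← Nat.card_eq_fintype_card (α := {v // M *ᵥ v = 0})]
  rfl

/-- The matrix on the points of the `h`-dimensional projective space over `ZMod q` with entry `-1`
for orthogonal points and `1` otherwise. As `q ^ h = 1` in `ZMod p`, the vector space has `q`
vectors, a hyperplane `1` and the intersection of two hyperplanes `1 / q`, all modulo `p`. -/
theorem exists_signMatrix_of_prime {p q h : ℕ} [Fact p.Prime] [Fact q.Prime]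
    (hq : (q : ZMod p) ^ h = 1) (hq1 : (q : ZMod p) ≠ 1) (hq0 : (q : ZMod p) ≠ 0) :
    ∃ (κ : Type) (_ : Fintype κ) (A : Matrix κ κ (ZMod p)),
      Fintype.card κ = ∑ i ∈ Finset.range (h + 1), q ^ i ∧ IsSignMatrix A ∧
      (∀ i, ∑ j, A i j = 1) ∧ Pairwise fun i j => A i ⬝ᵥ A j = 1 - 4 / (q : ZMod p) := by
  classical
  let _ : Fintype (ℙ (ZMod q) (Fin (h + 1) → ZMod q)) := Fintype.ofFinite _
  let s : (Fin (h + 1) → ZMod q) → (Fin (h + 1) → ZMod q) → ZMod p :=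
    fun x v => if x ⬝ᵥ v = 0 then -1 else 1
  -- Representatives serve for both arguments: orthogonality is invariant under scaling (`hA`).
  let A : Matrix (ℙ (ZMod q) (Fin (h + 1) → ZMod q)) (ℙ (ZMod q) (Fin (h + 1) → ZMod q)) (ZMod p) :=
    Matrix.of fun P Q => s P.rep Q.rep
  have hA : ∀ P v (hv : v ≠ 0), s P.rep v = A P (Projectivization.mk (ZMod q) v hv) := by
    intro P v hv
    obtain ⟨a, ha⟩ := Projectivization.exists_smul_eq_mk_rep (ZMod q) v hv
    have : P.rep ⬝ᵥ (a • v) = 0 ↔ P.rep ⬝ᵥ v = 0 := by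
      rw [dotProduct_smul, smul_eq_zero_iff_eq]
    simp only [A, s, Matrix.of_apply, ← ha, this]
  have hq1' : (q : ZMod p) - 1 ≠ 0 := sub_ne_zero.2 hq1
  have hker : ∀ {m : ℕ} (M : Matrix (Fin m) (Fin (h + 1)) (ZMod q)),
      LinearIndependent (ZMod q) M.row →
      (Fintype.card {v // M *ᵥ v = 0} : ZMod p) * q ^ m = q := by
    intro m M hM
    have := congrArg (Nat.cast (R := ZMod p)) (M.card_ker_mulVec_mul_pow hM)
    simpa [ZMod.card, pow_succ, hq] using this
  have hone : ∀ P : ℙ (ZMod q) (Fin (h + 1) → ZMod q),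
      ∑ v, (if P.rep ⬝ᵥ v = 0 then 1 else 0 : ZMod p) = 1 := by
    intro P
    have := hker (Matrix.of ![P.rep]) (by
      rw [linearIndependent_unique_iff]
      exact P.rep_nonzero)
    rw [pow_one] at this
    have h1 := mul_right_cancel₀ hq0 (this.trans (one_mul _).symm)
    rw [Finset.sum_boole, ← Fintype.card_subtype, ← h1]
    congr 1
    refine Fintype.card_congr (Equiv.subtypeEquivRight fun v => ?_)
    simp [funext_iff]
  have htwo : ∀ P Q : ℙ (ZMod q) (Fin (h + 1) → ZMod q), P ≠ Q →
      ∑ v, (if P.rep ⬝ᵥ v = 0 ∧ Q.rep ⬝ᵥ v = 0 then 1 else 0 : ZMod p) = 1 / q := by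
    intro P Q hPQ
    have := hker (Matrix.of ![P.rep, Q.rep]) (by
      have := (Projectivization.independent_iff).1
        ((Projectivization.independent_pair_iff_ne P Q).2 hPQ)
      have hrow : (Matrix.of ![P.rep, Q.rep]).row = Projectivization.rep ∘ ![P, Q] := by
        ext i : 1
        fin_cases i <;> rfl
      rwa [hrow])
    rw [eq_div_iff hq0]
    have h1 := mul_right_cancel₀ hq0 ((mul_assoc _ _ _).trans
      ((congrArg _ (sq _).symm).trans (this.trans (one_mul _).symm)))
    rw [Finset.sum_boole, ← Fintype.card_subtype, ← h1]
    congr 2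
    refine Fintype.card_congr (Equiv.subtypeEquivRight fun v => ?_)
    simp [funext_iff, Fin.forall_fin_two]
  have hs0 : ∀ x, s x 0 = -1 := fun x => by simp [s]
  have hs : ∀ x v, s x v = 1 - 2 * (if x ⬝ᵥ v = 0 then 1 else 0) := fun x v => by
    simp only [s]; split_ifs <;> norm_num
  have hcardV : (Fintype.card (Fin (h + 1) → ZMod q) : ZMod p) = q := by
    simp [ZMod.card, pow_succ, hq]
  refine ⟨ℙ (ZMod q) (Fin (h + 1) → ZMod q), inferInstance, A, ?_, fun P Q => ?_, fun P => ?_,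
    fun P Q hPQ => ?_⟩
  · have := Projectivization.card_of_finrank (ZMod q) (Fin (h + 1) → ZMod q) (n := h + 1) (by simp)
    simpa using this
  · simp only [A, s, Matrix.of_apply]
    split_ifs <;> simp
  · have h1 := Projectivization.sum_eq_add_card_sub_one_mul_sum (A P) (s P.rep) (hA P)
    have h2 : ∑ v, s P.rep v = q - 2 := by
      simp only [hs, Finset.sum_sub_distrib, ← Finset.mul_sum, hone]
      simp [pow_succ, hq]
    rw [h2, hs0, ZMod.card] at h1
    apply mul_left_cancel₀ hq1'
    linear_combination -h1
  · have h1 := Projectivization.sum_eq_add_card_sub_one_mul_sum (fun R => A P R * A Q R)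
      (fun v => s P.rep v * s Q.rep v) (fun v hv => by rw [hA P v hv, hA Q v hv])
    have h2 : ∑ v, s P.rep v * s Q.rep v = q - 4 + 4 / q := by
      have h3 : ∀ v, s P.rep v * s Q.rep v = 1 - 2 * (if P.rep ⬝ᵥ v = 0 then 1 else 0)
          - 2 * (if Q.rep ⬝ᵥ v = 0 then 1 else 0)
          + 4 * (if P.rep ⬝ᵥ v = 0 ∧ Q.rep ⬝ᵥ v = 0 then 1 else 0) := by
        intro v
        rw [ite_and, hs, hs]
        split_ifs <;> ring
      simp only [h3, Finset.sum_sub_distrib, Finset.sum_add_distrib, ← Finset.mul_sum, hone,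
        htwo P Q hPQ]
      simp only [Finset.sum_const, Finset.card_univ, nsmul_eq_mul, hcardV]
      ring
    rw [h2, hs0, hs0, ZMod.card] at h1
    apply mul_left_cancel₀ hq1'
    rw [dotProduct, ← sub_eq_zero]
    field_simp at h1 ⊢
    linear_combination -h1

/-! ### The greatest common divisor of the increments -/

/-- If `u` fails, then `u + p` works: `(u + p) ^ h ≡ u ^ h + h u ^ (h - 1) p (mod p²)`. -/
theorem Nat.exists_modEq_pow_not_modEq_one {p u h : ℕ} (hp : p.Prime) (hu : ¬ p ∣ u)
    (hh : ¬ p ∣ h) : ∃ w, w ≡ u [MOD p] ∧ ¬ w ^ h ≡ 1 [MOD p ^ 2] := by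
  by_contra! hcon
  have h0 := hcon u rfl
  have h1 := hcon (u + p) (by simp [Nat.ModEq])
  obtain ⟨k, hk⟩ := Polynomial.powAddExpansion u p h
  have h2 : u ^ h + h * u ^ (h - 1) * p ≡ u ^ h + 0 [MOD p ^ 2] := by
    refine (Nat.ModEq.trans ?_ h1).trans (h0.symm.trans (by rfl))
    rw [hk]
    simp [Nat.ModEq]
  have h3 := (Nat.modEq_zero_iff_dvd.1 (Nat.ModEq.add_left_cancel' _ h2))
  rw [sq] at h3
  have h4 := Nat.dvd_of_mul_dvd_mul_right hp.pos h3
  rcases hp.dvd_mul.1 h4 with h5 | h5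
  · exact hh h5
  · exact hu (hp.dvd_of_dvd_pow h5)

/-- For `h` odd and prime to `p`, a common divisor of the numbers `q + q² + ⋯ + q ^ h`, where `q`
runs over the primes in a fixed nonzero class modulo `p`, divides `p`. A single prime `q` bounds
both parts of the common divisor `p ^ j * N` with `N` prime to `p`: taking `q ^ h ≢ 1 (mod p²)`
gives `j ≤ 1`, and taking `q ≡ -1 (mod N)` turns the sum into `-1` modulo `N`. -/
theorem setGcd_geom_sum_dvd {p h : ℕ} (hp : p.Prime) (hh : Odd h) (hph : ¬ p ∣ h) {u : ZMod p}
    (hu : u ≠ 0) :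
    Nat.setGcd {e | ∃ q : ℕ, q.Prime ∧ (q : ZMod p) = u ∧ e = q * ∑ i ∈ Finset.range h, q ^ i}
      ∣ p := by
  have := Fact.mk hp
  set S := {e | ∃ q : ℕ, q.Prime ∧ (q : ZMod p) = u ∧ e = q * ∑ i ∈ Finset.range h, q ^ i}
  have hu' : ¬ p ∣ u.val := fun hd => hu (by
    rw [← ZMod.natCast_zmod_val u]; exact (ZMod.natCast_eq_zero_iff _ _).2 hd)
  obtain ⟨w, hwu, hw⟩ := Nat.exists_modEq_pow_not_modEq_one hp hu' hph
  have hwp : (w : ZMod p) = u := by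
    rw [(ZMod.natCast_eq_natCast_iff _ _ _).2 hwu, ZMod.natCast_zmod_val]
  have hw' : w.Coprime p := (Nat.Coprime.symm <| (hp.coprime_iff_not_dvd).2 fun hd => hu (by
    rw [← hwp]; exact (ZMod.natCast_eq_zero_iff _ _).2 hd))
  have hne : Nat.setGcd S ≠ 0 := by
    obtain ⟨q, -, hq, hqw⟩ := Nat.forall_exists_prime_gt_and_modEq 0 hp.ne_zero hw'
    intro h0
    have := Nat.setGcd_eq_zero_iff.1 h0 ⟨q, hq, by
      rw [(ZMod.natCast_eq_natCast_iff _ _ _).2 hqw, hwp], rfl⟩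
    obtain ⟨k, rfl⟩ := hh
    rw [Finset.sum_range_succ] at this
    simp [hq.ne_zero] at this
  obtain ⟨j, N, hN, hg⟩ := Nat.exists_eq_pow_mul_and_not_dvd hne p hp.ne_one
  have hN0 : N ≠ 0 := by rintro rfl; simp at hN
  have hcop : (p ^ 2).Coprime N := Nat.Coprime.pow_left _ ((hp.coprime_iff_not_dvd).2 hN)
  obtain ⟨t, ht1, ht2⟩ := Nat.chineseRemainder hcop w (N - 1)
  have htcop : t.Coprime (p ^ 2 * N) := by
    refine Nat.Coprime.mul_right ?_ ?_
    · rw [Nat.Coprime, ht1.gcd_eq]; exact hw'.pow_right 2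
    · rw [Nat.Coprime, ht2.gcd_eq]
      have := Nat.coprime_self_sub_left (m := 1) (n := N) (by lia)
      simpa using this
  obtain ⟨q, -, hq, hqt⟩ := Nat.forall_exists_prime_gt_and_modEq 0
    (mul_ne_zero (pow_ne_zero 2 hp.ne_zero) hN0) htcop
  have hqw : q ≡ w [MOD p ^ 2] := (hqt.of_mul_right _).trans ht1
  have hqN : q ≡ N - 1 [MOD N] := (hqt.of_mul_left _).trans ht2
  have hqu : (q : ZMod p) = u := by
    rw [← hwp, ZMod.natCast_eq_natCast_iff]
    exact hqw.of_dvd (dvd_pow_self p two_ne_zero)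
  have hdvd := Nat.setGcd_dvd_of_mem (s := S) ⟨q, hq, hqu, rfl⟩
  have hN1 : N = 1 := by
    have h1 : (q : ZMod N) = -1 := by
      rw [(ZMod.natCast_eq_natCast_iff _ _ _).2 hqN, Nat.cast_sub (by lia)]
      simp
    have h2 := (ZMod.natCast_eq_zero_iff _ N).2 ((Dvd.intro_left _ hg.symm).trans hdvd)
    have hne : ¬ Even h := Nat.not_even_iff_odd.2 hh
    have h3 : ((1 : ℕ) : ZMod N) = 0 := by
      push_cast at h2
      rw [h1, neg_one_geom_sum, if_neg hne] at h2
      simpa using h2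
    exact Nat.dvd_one.1 ((ZMod.natCast_eq_zero_iff _ _).1 h3)
  have hj : j ≤ 1 := by
    by_contra! hj
    have h1 : p ^ 2 ∣ q * ∑ i ∈ Finset.range h, q ^ i :=
      ((pow_dvd_pow p hj).trans (Dvd.intro _ hg.symm)).trans hdvd
    have hpq : (p ^ 2).Coprime q := by
      rw [Nat.coprime_comm, Nat.Coprime, hqw.gcd_eq]
      exact hw'.pow_right 2
    have h2 := (ZMod.natCast_eq_zero_iff _ _).2 (hpq.dvd_of_dvd_mul_left h1)
    push_cast at h2
    have h3 := geom_sum_mul (q : ZMod (p ^ 2)) h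
    rw [h2, zero_mul, eq_comm, sub_eq_zero] at h3
    apply hw
    refine (hqw.symm.pow h).trans ?_
    rw [← ZMod.natCast_eq_natCast_iff]
    simpa using h3
  rw [hg, hN1, mul_one]
  exact pow_dvd_pow p hj |>.trans (by simp)

/-! ### All large orders -/

/-- Blowing up with the projective space over `ZMod q`, whose number of points exceeds `1` by
`q + q² + ⋯ + q ^ h`. -/
theorem ExistsMH.add_geom_sum {p q h n : ℕ} [Fact p.Prime] (hq : q.Prime)
    (hh : (q : ZMod p) ^ h = 1) (hq1 : (q : ZMod p) ≠ 1) (hqn : (q : ZMod p) * n = 4)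
    (hn : n ≠ 0) (hq0 : (q : ZMod p) ≠ 0) (H : ExistsMH n p) :
    ExistsMH (n + q * ∑ i ∈ Finset.range h, q ^ i) p := by
  have := Fact.mk hq
  obtain ⟨κ, _, A, hcard, hA, hrow, hgram⟩ := exists_signMatrix_of_prime hh hq1 hq0
  obtain ⟨n, rfl⟩ := Nat.exists_eq_succ_of_ne_zero hn
  have hgeom : (∑ i ∈ Finset.range h, (q : ZMod p) ^ i) = 0 := by
    have := geom_sum_mul (q : ZMod p) h
    rw [hh, sub_self] at this
    exact (mul_eq_zero.1 this).resolve_right (sub_ne_zero.2 hq1)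
  have hcard' : Fintype.card κ = q * (∑ i ∈ Finset.range h, q ^ i) + 1 := by
    rw [hcard, geom_sum_succ]
  have hblow := H.blowup (by rw [hcard']; push_cast; rw [hgeom]; simp) A hA hrow
    (fun i j hij => by
      refine (hgram hij).trans ?_
      rw [← hqn]
      push_cast
      field_simp
      ring)
  rw [hcard'] at hblow
  convert hblow using 1
  rw [Nat.succ_eq_add_one]
  ring

theorem finite_setOf_not_existsMH_of_cast_eq_sq {p : ℕ} [Fact p.Prime] (hp4 : p ≡ 3 [MOD 4])
    (h2 : IsPrimitiveRoot (2 : ZMod p) (p - 1)) (x : ZMod p) :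
    {n : ℕ | (n : ZMod p) = x ^ 2 ∧ ¬ ExistsMH n p}.Finite := by
  have hp := Fact.out (p := p.Prime)
  rcases eq_or_ne x 0 with rfl | hx
  · refine Set.Finite.subset Set.finite_empty fun n hn => hn.2 (existsMH_of_cast_eq_zero ?_)
    simpa using hn.1
  rcases eq_or_ne (x ^ 2) 4 with hx4 | hx4
  · exact Set.Finite.subset Set.finite_empty fun n hn =>
      hn.2 (existsMH_of_cast_eq_four (hn.1.trans hx4))
  obtain ⟨c, hc⟩ : ∃ c, p = 4 * c + 3 := ⟨p / 4, by have : p % 4 = 3 := hp4; lia⟩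
  have htwo : (2 : ZMod p) ≠ 0 := by
    intro h0
    have := (ZMod.natCast_eq_zero_iff 2 p).1 (by simpa using h0)
    have := Nat.le_of_dvd two_pos this
    lia
  -- `h` is the odd number `(p - 1) / 2`, and `u = 4 / x ^ 2` the residue of the primes `q`.
  set h := 2 * c + 1 with hh
  set u : ZMod p := (2 / x) ^ 2 with hu
  have hu0 : u ≠ 0 := pow_ne_zero _ (div_ne_zero htwo hx)
  have hux : u * x ^ 2 = 4 := by rw [hu]; field_simp; norm_num
  have hu1 : u ≠ 1 := fun h1 => hx4 (by rw [← hux, h1, one_mul])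
  have huh : u ^ h = 1 := by
    rw [hu, ← pow_mul, show 2 * h = p - 1 by lia]
    exact ZMod.pow_card_sub_one_eq_one (div_ne_zero htwo hx)
  -- As `x` is a power of `2`, its square is the residue of the order of a Hadamard matrix.
  have hstart : ∃ t : ℕ, t ≠ 0 ∧ (t : ZMod p) = x ^ 2 ∧ ExistsMH t p := by
    have : NeZero (p - 1) := ⟨by lia⟩
    obtain ⟨k, -, hk⟩ := h2.eq_pow_of_pow_eq_one (ZMod.pow_card_sub_one_eq_one hx)
    exact ⟨2 ^ (k * 2), by positivity, by rw [← hk]; push_cast; ring, existsMH_two_pow _ _⟩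
  obtain ⟨t, ht0, htx, ht⟩ := hstart
  set S := {e | ∃ q : ℕ, q.Prime ∧ (q : ZMod p) = u ∧ e = q * ∑ i ∈ Finset.range h, q ^ i}
  have hSp : ∀ e ∈ S, (e : ZMod p) = 0 := by
    rintro e ⟨q, -, hqu, rfl⟩
    have := geom_sum_mul u h
    rw [huh, sub_self] at this
    push_cast
    rw [hqu, (mul_eq_zero.1 this).resolve_right (sub_ne_zero.2 hu1), mul_zero]
  have hadd : ∀ e ∈ AddSubmonoid.closure S, ∀ n : ℕ, n ≠ 0 → (n : ZMod p) = x ^ 2 →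
      ExistsMH n p → ExistsMH (n + e) p := by
    intro e he
    have hep : (e : ZMod p) = 0 ∧ ∀ n : ℕ, n ≠ 0 → (n : ZMod p) = x ^ 2 →
        ExistsMH n p → ExistsMH (n + e) p := by
      induction he using AddSubmonoid.closure_induction with
      | mem e he =>
        refine ⟨hSp e he, fun n hn hnx H => ?_⟩
        obtain ⟨q, hq, hqu, rfl⟩ := he
        exact H.add_geom_sum hq (by rw [hqu, huh]) (by rwa [hqu]) (by rw [hqu, hnx, hux]) hn
          (by rwa [hqu])
      | zero => exact ⟨by simp, fun n _ _ H => H⟩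
      | add a b _ _ iha ihb =>
        refine ⟨by push_cast; rw [iha.1, ihb.1, add_zero], fun n hn hnx H => ?_⟩
        rw [← add_assoc]
        exact ihb.2 _ (by lia) (by push_cast; rw [hnx, iha.1, add_zero]) (iha.2 n hn hnx H)
    exact hep.2
  have hgcd : Nat.setGcd S ∣ p := setGcd_geom_sum_dvd hp ⟨c, hh⟩
    (fun hd => by have := Nat.le_of_dvd (by lia) hd; lia) hu0
  obtain ⟨N, hN⟩ := Nat.exists_mem_closure_of_ge S
  refine (Set.finite_lt_nat (t + N)).subset fun n hn => ?_
  by_contra hlt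
  rw [Set.mem_ofPred_eq, not_lt] at hlt
  have hdvd : p ∣ n - t := by
    rw [← ZMod.natCast_eq_zero_iff, Nat.cast_sub (by lia), hn.1, htx, sub_self]
  apply hn.2
  have := hadd (n - t) (hN _ (by lia) (hgcd.trans hdvd)) t ht0 htx ht
  rwa [Nat.add_sub_cancel' (by lia)] at this

theorem isQuadraticNonresidue_iff {p n : ℕ} [Fact p.Prime] :
    IsQuadraticNonresidue p n ↔ ¬ IsSquare (n : ZMod p) := by
  refine not_congr ⟨fun ⟨x, hx⟩ => ⟨x, ?_⟩, fun ⟨x, hx⟩ => ⟨x.val, ?_⟩⟩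
  · have := (ZMod.natCast_eq_natCast_iff _ _ _).2 hx
    rw [← this]; push_cast; ring
  · rw [← ZMod.natCast_eq_natCast_iff, hx]
    push_cast
    rw [ZMod.natCast_zmod_val, sq]

theorem mainTheorem3 (p : ℕ) (hp : p.Prime) (hp4 : p ≡ 3 [MOD 4])
    (h2 : IsPrimitiveRoot (2 : ZMod p) (p - 1)) (hcond : PrimePowerCondition p) :
    {n : ℕ | ¬ (ExistsMH n p ↔ ¬ (Odd n ∧ IsQuadraticNonresidue p n))}.Finite := by
  have := Fact.mk hp
  have hfin : {n : ℕ | IsSquare (n : ZMod p) ∧ ¬ ExistsMH n p}.Finite := by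
    refine (Set.finite_iUnion (finite_setOf_not_existsMH_of_cast_eq_sq hp4 h2)).subset ?_
    rintro n ⟨⟨x, hx⟩, hn⟩
    exact Set.mem_iUnion.2 ⟨x, by rw [hx, sq], hn⟩
  refine (hfin.union (hfin.image (2 * ·))).subset fun n hn => ?_
  have hn' : ¬ ExistsMH n p ∧ ¬ (Odd n ∧ IsQuadraticNonresidue p n) := by
    have : ExistsMH n p → ¬ (Odd n ∧ IsQuadraticNonresidue p n) := fun H ho =>
      isQuadraticNonresidue_iff.1 ho.2 (H.isSquare_of_odd ho.1)
    have hn : ¬ _ := hn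
    tauto
  rw [isQuadraticNonresidue_iff] at hn'
  by_cases hsq : IsSquare (n : ZMod p)
  · exact Or.inl ⟨hsq, hn'.1⟩
  · have heven : Even n := Nat.not_odd_iff_even.1 fun ho => hn'.2 ⟨ho, hsq⟩
    obtain ⟨m, rfl⟩ := heven.exists_two_nsmul
    rw [smul_eq_mul] at *
    refine Or.inr ⟨m, ⟨?_, fun H => hn'.1 H.two_mul⟩, rfl⟩
    have hm0 : (m : ZMod p) ≠ 0 := fun h0 => hsq ⟨0, by push_cast; rw [h0]; simp⟩
    have h3 : p % 4 = 3 := hp4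
    have : NeZero (p - 1) := ⟨by lia⟩
    -- As `2m` is a power of `2` and not a square, the exponent of `2` is odd.
    obtain ⟨k, -, hk⟩ := h2.eq_pow_of_pow_eq_one (ZMod.pow_card_sub_one_eq_one hm0)
    rcases Nat.even_or_odd' k with ⟨j, rfl | rfl⟩
    · exact ⟨2 ^ j, by rw [← hk]; ring⟩
    · exact absurd ⟨2 ^ (j + 1), by push_cast; rw [← hk]; ring⟩ hsq
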